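/- Consider the knapsack cover problem with $\eta\ge 1$ items and one bounded continuous variable (1-mkc): $$\mathrm{OPT}^{\mathbb Z}=\min\Big\{\bar v\alpha+\sum_{i=1}^{\eta}\bar f_i y_i \;:\; \sum_{i=1}^{\eta}\bar w_i y_i\ge \bar d-\alpha,\ 0\le\alpha\le\bar c,\ y\in\{0,1\}^{\eta}\Big\},$$ with real data $\bar v>0$, $\bar f_1\ge\bar f_2\ge\dots\ge\bar f_\eta>0$, $0<\bar w_i\le\bar d$ for all $i$, and $0<\bar c\le\bar d$; the instance is assumed to be feasible. For $\varepsilon\in(0,1)$ let $K$ be the smallest integer with $(1+\varepsilon)^{-K}\le\varepsilon$ and let $J=\lceil 1+1/\varepsilon\rceil$. A signature is a vector $\sigma\in\{0,1,\dots,J\}^K$. For $h\in\{1,\dots,\eta\}$ and $k\in\{1,\dots,K\}$ let $$S^{h,k}=\{\,i>h : \bar f_h(1+\varepsilon)^{-(k-1)}\ge\bar f_i>\bar f_h(1+\varepsilon)^{-k}\,\},$$ and let $P^{h,\sigma}$ be the set of all $(y,\alpha)\in[0,1]^\eta\times\mathbb R$ such that $\sum_i\bar w_iy_i\ge\bar d-\alpha$,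 $0\le\alpha\le\bar c$, $y_1=\dots=y_{h-1}=0$, $y_h=1$, $\sum_{i\in S^{h,k}}y_i=\sigma_k$ for every $k$ with $\sigma_k<J$, and $\sum_{i\in S^{h,k}}y_i\ge J$ for every $k$ with $\sigma_k=J$. Let $$Q=\operatorname{conv}\Big(\bigcup_{h,\sigma}P^{h,\sigma}\Big)\ \text{ if }\bar c<\bar d,\qquad Q=\operatorname{conv}\Big(\{(0,\bar d)\}\cup\bigcup_{h,\sigma}P^{h,\sigma}\Big)\ \text{ if }\bar c=\bar d .$$ Theorem. There are absolute constants $A,B$ such that for every $\varepsilon\in(0,1)$, every $\eta\ge1$ and every feasible instance of 1-mkc with $\eta$ items as above there is a system of linear inequalities in the variables $y\in\mathbb R^\eta$, $\alpha\in\mathbb R$ and further auxiliary real variables, with at most $A\,(1/\varepsilon)^{B/\varepsilon^2}\,\eta^2$ variables and at most $A\,(1/\varepsilon)^{B/\varepsilon^2}\,\eta^2$ inequalities, whose solution set projects onto $Q$ in the $(y,\alpha)$-space. It is a relaxation of 1-mkc, that is, $Q$ contains every feasible solution of 1-mkc. Moreover the minimum $\mathrm{OPT}(\varepsilon)$ of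 $\bar v\alpha+\sum_i\bar f_iy_i$ over the solutions of this system and the minimum $\mathrm{OPT}^{\mathbb Z}$ are attained, and $$\mathrm{OPT}^{\mathbb Z}<(1+\varepsilon)\,\mathrm{OPT}(\varepsilon).$$ -/

import Mathlib

/-- An instance of the knapsack cover problem with `η` items and one bounded continuous variable:
item costs `f`, item weights `w`, unit cost `v` and upper bound `c` of the continuous variable,
and demand `d`. Items are listed by non-increasing cost. -/
structure KnapsackCover (η : ℕ) where
  f : Fin η → ℝ
  w : Fin η → ℝ
  v : ℝ
  d : ℝ
  c : ℝ
  f_pos : ∀ i, 0 < f i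
  v_pos : 0 < v
  w_pos : ∀ i, 0 < w i
  w_le : ∀ i, w i ≤ d
  c_pos : 0 < c
  c_le : c ≤ d
  f_sorted : Antitone f

namespace KnapsackCover

variable {η : ℕ}

/-- The objective function `∑ f_i y_i + v α`. -/
def cost (I : KnapsackCover η) (p : (Fin η → ℝ) × ℝ) : ℝ :=
  ∑ i, I.f i * p.1 i + I.v * p.2

/-- The feasible points `(y, α)` of the mixed-integer problem. -/
def feasible (I : KnapsackCover η) : Set ((Fin η → ℝ) × ℝ) :=
  {p | I.d - p.2 ≤ ∑ i, I.w i * p.1 i ∧ 0 ≤ p.2 ∧ p.2 ≤ I.c ∧ ∀ i, p.1 i = 0 ∨ p.1 i = 1}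

/-- `K`: the least integer with `(1 + ε)^(-K) ≤ ε`; it is nonnegative, as `ε < 1`. -/
noncomputable def numClasses (ε : ℝ) : ℕ :=
  sInf {K : ℕ | ((1 + ε) ^ K)⁻¹ ≤ ε}

/-- `J = ⌈1 + 1/ε⌉`. -/
noncomputable def countCap (ε : ℝ) : ℕ :=
  ⌈1 + 1 / ε⌉₊

/-- The cost class `S^{h,k+1}` (here `k` counts from `0`): the items `i > h` with
`f_h (1 + ε)^(-k) ≥ f_i > f_h (1 + ε)^(-(k+1))`. -/
noncomputable def costClass (I : KnapsackCover η) (ε : ℝ) (h : Fin η) (k : ℕ) : Finset (Fin η) :=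
  by
    classical
    exact Finset.univ.filter fun i =>
      I.f i ≤ I.f h / (1 + ε) ^ k ∧ I.f h / (1 + ε) ^ (k + 1) < I.f i ∧ h < i

/-- Signatures: vectors indexed by the `K` classes with entries in `{0, …, J}`. -/
abbrev Signature (ε : ℝ) : Type :=
  Fin (numClasses ε) → Fin (countCap ε + 1)

/-- The polyhedron `P^{h,σ}`. -/
def piece (I : KnapsackCover η) (ε : ℝ) (h : Fin η) (σ : Signature ε) :
    Set ((Fin η → ℝ) × ℝ) :=
  {p | (∀ i, 0 ≤ p.1 i ∧ p.1 i ≤ 1) ∧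
    I.d - p.2 ≤ ∑ i, I.w i * p.1 i ∧ 0 ≤ p.2 ∧ p.2 ≤ I.c ∧
    (∀ i, i < h → p.1 i = 0) ∧ p.1 h = 1 ∧
    (∀ k, (σ k : ℕ) < countCap ε → ∑ i ∈ I.costClass ε h k, p.1 i = ((σ k : ℕ) : ℝ)) ∧
    (∀ k, (σ k : ℕ) = countCap ε → (countCap ε : ℝ) ≤ ∑ i ∈ I.costClass ε h k, p.1 i)}

/-- The union of all the polyhedra `P^{h,σ}`. -/
def pieces (I : KnapsackCover η) (ε : ℝ) : Set ((Fin η → ℝ) × ℝ) :=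
  ⋃ (h : Fin η) (σ : Signature ε), I.piece ε h σ

end KnapsackCover

/-- A finite system of linear inequalities in the variables `y ∈ ℝ^η`, `α ∈ ℝ` and `numAux`
auxiliary real variables `z`: the `r`-th one reads `⟨ay r, y⟩ + aα r * α + ⟨az r, z⟩ ≤ b r`. -/
structure ExtendedSystem (η : ℕ) where
  numAux : ℕ
  numCons : ℕ
  ay : Fin numCons → Fin η → ℝ
  aα : Fin numCons → ℝ
  az : Fin numCons → Fin numAux → ℝ
  b : Fin numCons → ℝ

namespace ExtendedSystem

variable {η : ℕ}

/-- The number of all the variables `y`, `α`, `z`. -/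
def numVars (R : ExtendedSystem η) : ℕ :=
  η + 1 + R.numAux

/-- The solutions `((y, α), z)` of the system. -/
def solutions (R : ExtendedSystem η) : Set (((Fin η → ℝ) × ℝ) × (Fin R.numAux → ℝ)) :=
  {q | ∀ r, ∑ i, R.ay r i * q.1.1 i + R.aα r * q.1.2 + ∑ s, R.az r s * q.2 s ≤ R.b r}

/-- The projection of the solution set to the variables `(y, α)`. -/
def projection (R : ExtendedSystem η) : Set ((Fin η → ℝ) × ℝ) :=
  Prod.fst '' R.solutions

end ExtendedSystem

/-! Guess the first (hence most expensive) chosen item `h` and, for each geometric cost class after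
it, the number of chosen items, capped at `J`. Every integral solution with an item fits some guess;
the one without items needs `α = d`, hence `c = d`. Each guess gives a bounded polyhedron, so Balas'
construction (`convexHull_iUnion_polyhedra`) describes the hull of their union with one scaled copy
of `(y, α)` per guess. The size is governed by the number of guesses, at most `η (J+1)^K + 1`.

A linear cost attains its minimum over the hull at a point of the union, so it suffices to round a
point of a single piece (`exists_feasible_cost_lt`), keeping `α` and losing no weight. Shifting mass
leaves at most one fractional item per class (`exists_card_fractional_le_one`). If the count of a
class is exact, equally many whole items weigh at least as much, and costs within a class differ by
a factor below `1 + ε`. If the count is at least `J`, rounding one item up adds at most `ε` times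
the cost of the class. Items after `h` in no class cost at most `ε f_h`; rounding one of them up is
paid for by the slack `ε f_h` left by keeping `h` at its exact cost. -/

/-! ### Rounding fractional selections -/

section Rounding

variable {α : Type*} [DecidableEq α]

/-- Shifting mass between two fractional coordinates leaves at most one of them fractional. -/
theorem exists_card_fractional_le_one (s : Finset α) (u g y : α → ℝ)
    (hu : ∀ i ∈ s, 0 < u i) (hy : ∀ i ∈ s, 0 ≤ y i ∧ y i ≤ 1) :
    ∃ y' : α → ℝ, (∀ i ∈ s, 0 ≤ y' i ∧ y' i ≤ 1) ∧
      (s.filter fun i => 0 < y' i ∧ y' i < 1).card ≤ 1 ∧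
      ∑ i ∈ s, u i * y' i = ∑ i ∈ s, u i * y i ∧
      ∑ i ∈ s, g i * y' i ≤ ∑ i ∈ s, g i * y i := by
  induction hn : (s.filter fun i => 0 < y i ∧ y i < 1).card using Nat.strong_induction_on
    generalizing y with
  | _ n ih =>
  by_cases h1 : n ≤ 1
  · exact ⟨y, hy, hn ▸ h1, rfl, le_rfl⟩
  have h2 : 1 < (s.filter fun i => 0 < y i ∧ y i < 1).card := by omega
  -- Mass will move from `b` to `a`, the coordinate with the smaller cost per unit of `u`.
  obtain ⟨a, b, ha, hb, hab, hr⟩ : ∃ a b, a ∈ (s.filter fun i => 0 < y i ∧ y i < 1) ∧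
      b ∈ (s.filter fun i => 0 < y i ∧ y i < 1) ∧ a ≠ b ∧ g a / u a ≤ g b / u b := by
    obtain ⟨a, ha, b, hb, hab⟩ := Finset.one_lt_card.mp h2
    rcases le_total (g a / u a) (g b / u b) with h | h
    · exact ⟨a, b, ha, hb, hab, h⟩
    · exact ⟨b, a, hb, ha, hab.symm, h⟩
  have haF := ha
  have hbF := hb
  simp only [Finset.mem_filter] at ha hb
  obtain ⟨has, ha0, ha1⟩ := ha
  obtain ⟨hbs, hb0, hb1⟩ := hb
  have hua := hu a has
  have hub := hu b hbs
  -- The largest amount of `u`-mass that keeps both coordinates in `[0, 1]`; moving it makes `a`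
  -- reach `1` or `b` reach `0`, so the number of fractional coordinates drops.
  set t := min (u a * (1 - y a)) (u b * y b) with ht
  have ht0 : 0 < t := lt_min (mul_pos hua (by linarith)) (mul_pos hub hb0)
  have hta : t / u a ≤ 1 - y a := by
    rw [div_le_iff₀ hua, mul_comm]; exact min_le_left _ _
  have htb : t / u b ≤ y b := by
    rw [div_le_iff₀ hub, mul_comm]; exact min_le_right _ _
  have hta0 : 0 < t / u a := div_pos ht0 hua
  have htb0 : 0 < t / u b := div_pos ht0 hub
  let z : α → ℝ := fun i => y i + (if i = a then t / u a else 0) - (if i = b then t / u b else 0)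
  have hza : z a = y a + t / u a := by simp [z, hab]
  have hzb : z b = y b - t / u b := by simp [z, hab.symm]
  have hz : ∀ i, i ≠ a → i ≠ b → z i = y i := fun i h h' => by simp [z, h, h']
  have hzs : ∀ c : α → ℝ, ∑ i ∈ s, c i * z i =
      ∑ i ∈ s, c i * y i + c a * (t / u a) - c b * (t / u b) := fun c => by
    simp only [z, mul_sub, mul_add, Finset.sum_sub_distrib, Finset.sum_add_distrib, mul_ite,
      mul_zero, Finset.sum_ite_eq', has, hbs, if_true]
  have hz01 : ∀ i ∈ s, 0 ≤ z i ∧ z i ≤ 1 := fun i hi => by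
    by_cases hia : i = a
    · subst hia; rw [hza]; constructor <;> linarith
    by_cases hib : i = b
    · subst hib; rw [hzb]; constructor <;> linarith
    rw [hz i hia hib]; exact hy i hi
  have hsub : (s.filter fun i => 0 < z i ∧ z i < 1) ⊂ (s.filter fun i => 0 < y i ∧ y i < 1) := by
    refine Finset.ssubset_iff_subset_ne.mpr ⟨fun i hi => ?_, fun heq => ?_⟩
    · by_cases hia : i = a
      · exact hia ▸ haF
      by_cases hib : i = b
      · exact hib ▸ hbF
      simpa only [Finset.mem_filter, hz i hia hib] using hi
    · rw [← heq] at haF hbF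
      simp only [Finset.mem_filter, hza, hzb] at haF hbF
      rcases min_choice (u a * (1 - y a)) (u b * y b) with h | h
      · have : t / u a = 1 - y a := by rw [ht, h]; field_simp
        linarith [haF.2.2]
      · have : t / u b = y b := by rw [ht, h]; field_simp
        linarith [hbF.2.1]
  obtain ⟨y', h01, hc, hus, hgs⟩ := ih _ (hn ▸ Finset.card_lt_card hsub) z hz01 rfl
  refine ⟨y', h01, hc, ?_, hgs.trans ?_⟩
  · rw [hus, hzs]; field_simp; ring
  · rw [hzs]
    have : g a * (t / u a) ≤ g b * (t / u b) := by
      calc g a * (t / u a) = g a / u a * t := by ring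
        _ ≤ g b / u b * t := by gcongr
        _ = _ := by ring
    linarith

/-- A fractional knapsack cover can be rounded to a cover at the price of one item. -/
theorem exists_subset_cover_cost_lt (s : Finset α) (f w y : α → ℝ) (M : ℝ) (hM : 0 < M)
    (hf : ∀ i ∈ s, f i ≤ M) (hw : ∀ i ∈ s, 0 < w i) (hy : ∀ i ∈ s, 0 ≤ y i ∧ y i ≤ 1) :
    ∃ T ⊆ s, ∑ i ∈ s, w i * y i ≤ ∑ i ∈ T, w i ∧ ∑ i ∈ T, f i < ∑ i ∈ s, f i * y i + M := by
  obtain ⟨z, hz, hc, hus, hgs⟩ := exists_card_fractional_le_one s w f y hw hy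
  -- Taking the whole support rounds up the only fractional item, which costs less than `M`.
  refine ⟨s.filter fun i => 0 < z i, Finset.filter_subset _ _, ?_, ?_⟩
  · rw [← hus, Finset.sum_filter]
    refine Finset.sum_le_sum fun i hi => ?_
    split_ifs with h
    · nlinarith [hw i hi, (hz i hi).2]
    · nlinarith [hw i hi, (hz i hi).2]
  · suffices h : ∑ i ∈ s.filter (fun i => 0 < z i), f i - ∑ i ∈ s, f i * z i < M by linarith
    have : ∑ i ∈ s.filter (fun i => 0 < z i), f i - ∑ i ∈ s, f i * z i =
        ∑ i ∈ s.filter (fun i => 0 < z i ∧ z i < 1), f i * (1 - z i) := by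
      rw [Finset.sum_filter, Finset.sum_filter, ← Finset.sum_sub_distrib]
      refine Finset.sum_congr rfl fun i hi => ?_
      rcases (hz i hi).1.eq_or_lt with h0 | h0
      · simp [← h0]
      rcases (hz i hi).2.eq_or_lt with h1 | h1
      · simp [h1]
      · simp only [h0, h1, and_self, if_true]; ring
    rw [this]
    rcases Nat.le_one_iff_eq_zero_or_eq_one.mp hc with h | h
    · rw [Finset.card_eq_zero.mp h]; simpa using hM
    · obtain ⟨a, ha⟩ := Finset.card_eq_one.mp h
      have hm : a ∈ s.filter (fun i => 0 < z i ∧ z i < 1) := by simp [ha]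
      simp only [Finset.mem_filter] at hm
      rw [ha, Finset.sum_singleton]
      nlinarith [hf a hm.1]

/-- A fractional selection of total size `n` weighs at most as much as some `n` items. -/
theorem exists_subset_card_eq_weight_ge (s : Finset α) (w y : α → ℝ) (n : ℕ)
    (hy : ∀ i ∈ s, 0 ≤ y i ∧ y i ≤ 1) (hn : ∑ i ∈ s, y i = n) :
    ∃ T ⊆ s, T.card = n ∧ ∑ i ∈ s, w i * y i ≤ ∑ i ∈ T, w i := by
  -- With `u = 1` and `g = -w` the shifting preserves the total size and does not decrease the
  -- weight.
  obtain ⟨z, hz, hc, hus, hgs⟩ := exists_card_fractional_le_one s (fun _ => 1) (fun i => -w i) y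
    (fun _ _ => one_pos) hy
  simp only [one_mul, hn, neg_mul, Finset.sum_neg_distrib, neg_le_neg_iff] at hus hgs
  have hsplit : ∑ i ∈ s, z i = ((s.filter fun i => z i = 1).card : ℝ) +
      ∑ i ∈ s.filter (fun i => 0 < z i ∧ z i < 1), z i := by
    rw [Finset.card_filter, Finset.sum_filter, Nat.cast_sum, ← Finset.sum_add_distrib]
    refine Finset.sum_congr rfl fun i hi => ?_
    rcases (hz i hi).1.eq_or_lt with h0 | h0
    · simp [← h0]
    rcases (hz i hi).2.eq_or_lt with h1 | h1
    · simp [h1]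
    · simp [h0, h1, h1.ne]
  rw [hus] at hsplit
  -- A single fractional coordinate would put the integer `n` strictly between two consecutive
  -- integers.
  have hF : s.filter (fun i => 0 < z i ∧ z i < 1) = ∅ := by
    rcases Nat.le_one_iff_eq_zero_or_eq_one.mp hc with h | h
    · exact Finset.card_eq_zero.mp h
    · exfalso
      obtain ⟨a, ha⟩ := Finset.card_eq_one.mp h
      have hm : a ∈ s.filter (fun i => 0 < z i ∧ z i < 1) := by simp [ha]
      simp only [Finset.mem_filter] at hm
      rw [ha, Finset.sum_singleton] at hsplit
      have h1 : ((s.filter fun i => z i = 1).card : ℝ) < n := by linarith [hm.2.1]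
      have h2 : (n : ℝ) < (((s.filter fun i => z i = 1).card + 1 : ℕ) : ℝ) := by
        push_cast; linarith [hm.2.2]
      have := Nat.cast_lt.mp h1
      have := Nat.cast_lt.mp h2
      omega
  rw [hF, Finset.sum_empty, add_zero] at hsplit
  refine ⟨s.filter fun i => z i = 1, Finset.filter_subset _ _, by exact_mod_cast hsplit.symm,
    hgs.trans (le_of_eq ?_)⟩
  rw [Finset.sum_filter]
  refine Finset.sum_congr rfl fun i hi => ?_
  rcases (hz i hi).1.eq_or_lt with h0 | h0
  · simp [← h0]
  rcases (hz i hi).2.eq_or_lt with h1 | h1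
  · simp [h1]
  · have : i ∈ s.filter (fun i => 0 < z i ∧ z i < 1) := by simp [hi, h0, h1]
    simp [hF] at this

end Rounding

/-! ### Convex hulls of unions of polyhedra -/

section Hull

variable {E ι ρ : Type*} [AddCommGroup E] [Module ℝ E] [Fintype ι]

/-- Balas' description of the convex hull of finitely many polyhedra with trivial recession
cones. -/
theorem convexHull_iUnion_polyhedra (a : ι → ρ → E →ₗ[ℝ] ℝ) (b : ι → ρ → ℝ)
    (hrec : ∀ i x, (∀ r, a i r x ≤ 0) → x = 0) :
    convexHull ℝ (⋃ i, {x | ∀ r, a i r x ≤ b i r}) =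
      {p | ∃ z : ι → E × ℝ, (∀ i r, a i r (z i).1 ≤ (z i).2 * b i r) ∧ (∀ i, 0 ≤ (z i).2) ∧
        ∑ i, (z i).2 = 1 ∧ ∑ i, (z i).1 = p} := by
  classical
  apply Set.Subset.antisymm
  · refine convexHull_min ?_ ?_
    · intro p hp
      obtain ⟨j, hj⟩ := Set.mem_iUnion.mp hp
      refine ⟨fun i => if i = j then (p, 1) else 0, fun i r => ?_, fun i => ?_, ?_, ?_⟩
      · dsimp only
        split_ifs with h
        · subst h; simpa using hj r
        · simp
      · dsimp only; split_ifs <;> simp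
      · simp [apply_ite Prod.snd]
      · simp [apply_ite Prod.fst]
    · rintro p ⟨z, h1, h2, h3, h4⟩ q ⟨z', h1', h2', h3', h4'⟩ s t hs ht hst
      refine ⟨fun i => s • z i + t • z' i, fun i r => ?_, fun i => ?_, ?_, ?_⟩
      · simp only [Prod.fst_add, Prod.smul_fst, map_add, map_smul, smul_eq_mul, Prod.snd_add,
          Prod.smul_snd]
        nlinarith [mul_le_mul_of_nonneg_left (h1 i r) hs, mul_le_mul_of_nonneg_left (h1' i r) ht]
      · simp only [Prod.snd_add, Prod.smul_snd, smul_eq_mul]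
        have := h2 i
        have := h2' i
        positivity
      · simp only [Prod.snd_add, Prod.smul_snd, smul_eq_mul, Finset.sum_add_distrib,
          ← Finset.mul_sum, h3, h3', mul_one, hst]
      · simp only [Prod.fst_add, Prod.smul_fst, Finset.sum_add_distrib, ← Finset.smul_sum, h4, h4']
  · rintro p ⟨z, h1, h2, h3, rfl⟩
    -- A copy with multiplier `0` lies in the recession cone, which is trivial, so it contributes
    -- nothing to the sum.
    have hzero : ∀ i, (z i).2 = 0 → (z i).1 = 0 := fun i hi =>
      hrec i _ fun r => by simpa [hi] using h1 i r
    have hs1 : ∑ i, (z i).1 = ∑ i with (z i).2 ≠ 0, (z i).2 • ((z i).2⁻¹ • (z i).1) := by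
      rw [Finset.sum_filter]
      refine Finset.sum_congr rfl fun i _ => ?_
      split_ifs with h
      · rw [smul_smul, mul_inv_cancel₀ h, one_smul]
      · exact hzero i (not_not.mp h)
    rw [hs1]
    refine (convex_convexHull ℝ _).sum_mem (fun i _ => h2 i) ?_ fun i hi => ?_
    · rw [Finset.sum_filter_ne_zero, h3]
    · have hne : (z i).2 ≠ 0 := (Finset.mem_filter.mp hi).2
      have hpos : 0 < (z i).2 := lt_of_le_of_ne (h2 i) hne.symm
      refine subset_convexHull ℝ _ (Set.mem_iUnion.mpr ⟨i, fun r => ?_⟩)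
      rw [map_smul, smul_eq_mul, inv_mul_le_iff₀ hpos]
      exact h1 i r

end Hull

/-! ### Extended systems from linear functionals -/

namespace ExtendedSystem

variable {η : ℕ}

/-- Linear functionals on a finite-dimensional space of auxiliary variables give an extended
system. -/
theorem exists_of_linearMap {W ρ : Type*} [AddCommGroup W] [Module ℝ W] [FiniteDimensional ℝ W]
    [Fintype ρ] (L : ρ → (((Fin η → ℝ) × ℝ) × W) →ₗ[ℝ] ℝ) (b : ρ → ℝ) :
    ∃ R : ExtendedSystem η, R.numAux = Module.finrank ℝ W ∧ R.numCons = Fintype.card ρ ∧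
      R.projection = {p | ∃ z, ∀ r, L r (p, z) ≤ b r} := by
  classical
  let B := Module.finBasis ℝ W
  let e := (Fintype.equivFin ρ).symm
  have key : ∀ r (p : (Fin η → ℝ) × ℝ) (z : Fin (Module.finrank ℝ W) → ℝ),
      L r (p, ∑ s, z s • B s) = ∑ i, L r ((Pi.single i 1, 0), 0) * p.1 i +
        L r ((0, 1), 0) * p.2 + ∑ s, L r (0, B s) * z s := by
    intro r p z
    have h : ((p, ∑ s, z s • B s) : ((Fin η → ℝ) × ℝ) × W) =
        ∑ i, p.1 i • (((Pi.single i 1, 0), 0) : ((Fin η → ℝ) × ℝ) × W) +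
          p.2 • (((0, 1), 0) : ((Fin η → ℝ) × ℝ) × W) + ∑ s, z s • (0, B s) := by
      ext i
      · simp [Prod.fst_sum, Finset.sum_apply, Pi.single_apply]
      · simp [Prod.fst_sum, Prod.snd_sum]
      · simp [Prod.snd_sum]
    rw [h]
    simp only [map_add, map_sum, map_smul, smul_eq_mul, mul_comm]
  refine ⟨⟨Module.finrank ℝ W, Fintype.card ρ, fun r i => L (e r) ((Pi.single i 1, 0), 0),
    fun r => L (e r) ((0, 1), 0), fun r s => L (e r) (0, B s), fun r => b (e r)⟩, rfl, rfl, ?_⟩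
  ext p
  constructor
  · rintro ⟨⟨p', z⟩, hq, rfl⟩
    refine ⟨∑ s, z s • B s, fun r => ?_⟩
    have := hq (e.symm r)
    simp only [Equiv.apply_symm_apply] at this
    rw [key]
    exact this
  · rintro ⟨z, hz⟩
    refine ⟨(p, B.repr z), fun r => ?_, rfl⟩
    have := hz (e r)
    rw [← B.sum_repr z, key] at this
    exact this

/-- The convex hull of finitely many polyhedra with trivial recession cones as the projection of
an extended system. -/
theorem exists_projection_eq_convexHull {ι ρ : Type*} [Fintype ι] [Fintype ρ]
    (a : ι → ρ → ((Fin η → ℝ) × ℝ) →ₗ[ℝ] ℝ) (b : ι → ρ → ℝ)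
    (hrec : ∀ i x, (∀ r, a i r x ≤ 0) → x = 0) :
    ∃ R : ExtendedSystem η,
      R.numVars = η + 1 + Fintype.card ι * (η + 2) ∧
      R.numCons = Fintype.card ι * Fintype.card ρ + Fintype.card ι + 2 * (η + 2) ∧
      R.projection = convexHull ℝ (⋃ i, {x | ∀ r, a i r x ≤ b i r}) := by
  classical
  let E := (Fin η → ℝ) × ℝ
  let V := E × (ι → E × ℝ)
  let x : ι → V →ₗ[ℝ] E := fun i =>
    LinearMap.fst ℝ E ℝ ∘ₗ LinearMap.proj i ∘ₗ LinearMap.snd ℝ E (ι → E × ℝ)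
  let l : ι → V →ₗ[ℝ] ℝ := fun i =>
    LinearMap.snd ℝ E ℝ ∘ₗ LinearMap.proj i ∘ₗ LinearMap.snd ℝ E (ι → E × ℝ)
  let δ : V →ₗ[ℝ] E := ∑ i, x i - LinearMap.fst ℝ E (ι → E × ℝ)
  -- The `η + 2` equations: the copies sum to `(y, α)` and the multipliers sum to `1`. In `L` each
  -- one becomes two inequalities.
  let eqs : Fin η ⊕ Unit ⊕ Unit → V →ₗ[ℝ] ℝ :=
    Sum.elim (fun i => LinearMap.proj i ∘ₗ LinearMap.fst ℝ (Fin η → ℝ) ℝ ∘ₗ δ)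
      (Sum.elim (fun _ => LinearMap.snd ℝ (Fin η → ℝ) ℝ ∘ₗ δ) (fun _ => ∑ i, l i))
  let rhs : Fin η ⊕ Unit ⊕ Unit → ℝ := Sum.elim (fun _ => 0) (Sum.elim (fun _ => 0) (fun _ => 1))
  let L : (ι × ρ) ⊕ ι ⊕ (Fin η ⊕ Unit ⊕ Unit) ⊕ (Fin η ⊕ Unit ⊕ Unit) → V →ₗ[ℝ] ℝ :=
    Sum.elim (fun ir => a ir.1 ir.2 ∘ₗ x ir.1 - b ir.1 ir.2 • l ir.1)
      (Sum.elim (fun i => -l i) (Sum.elim eqs (fun j => -eqs j)))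
  let c : (ι × ρ) ⊕ ι ⊕ (Fin η ⊕ Unit ⊕ Unit) ⊕ (Fin η ⊕ Unit ⊕ Unit) → ℝ :=
    Sum.elim (fun _ => 0) (Sum.elim (fun _ => 0) (Sum.elim rhs (fun j => -rhs j)))
  obtain ⟨R, hA, hC, hP⟩ := exists_of_linearMap (W := ι → E × ℝ) L c
  refine ⟨R, ?_, ?_, ?_⟩
  · rw [numVars, hA]
    simp [E, Module.finrank_pi_fintype, Module.finrank_prod]
  · rw [hC]
    simp
    ring
  · rw [hP, convexHull_iUnion_polyhedra a b hrec]
    ext p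
    refine exists_congr fun z => ?_
    have heqs : (∀ j, eqs j (p, z) = rhs j) ↔ ∑ i, (z i).2 = 1 ∧ ∑ i, (z i).1 = p := by
      have hδ : δ (p, z) = ∑ i, (z i).1 - p := by
        simp only [δ, LinearMap.sub_apply, LinearMap.sum_apply]; rfl
      have hl : (∑ i, l i) (p, z) = ∑ i, (z i).2 := by
        simp only [LinearMap.sum_apply]; rfl
      rw [← sub_eq_zero (a := ∑ i, (z i).1), ← hδ, ← hl, Prod.ext_iff, funext_iff]
      simp only [Sum.forall]
      exact ⟨fun h => ⟨h.2.2 (), h.1, h.2.1 ()⟩, fun h => ⟨h.2.1, fun _ => h.2.2, fun _ => h.1⟩⟩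
    rw [← heqs]
    simp only [Sum.forall (β := ι ⊕ _), Sum.forall (α := ι), Sum.forall (α := Fin η ⊕ Unit ⊕ Unit),
      L, c, Sum.elim_inl, Sum.elim_inr, Prod.forall, LinearMap.sub_apply, LinearMap.comp_apply,
      LinearMap.smul_apply, LinearMap.neg_apply, smul_eq_mul, sub_nonpos, neg_nonpos, neg_le_neg_iff]
    simp only [x, l, LinearMap.comp_apply, LinearMap.proj_apply, LinearMap.fst_apply,
      LinearMap.snd_apply, le_antisymm_iff, forall_and, mul_comm (b _ _)]

end ExtendedSystem

/-! ### The number of classes and signatures -/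

namespace KnapsackCover

theorem numClasses_spec {ε : ℝ} (h0 : 0 < ε) : ((1 + ε) ^ numClasses ε)⁻¹ ≤ ε := by
  -- Needed because `sInf ∅ = 0` in `ℕ`, which need not satisfy the bound.
  have hne : {K : ℕ | ((1 + ε) ^ K)⁻¹ ≤ ε}.Nonempty := by
    obtain ⟨n, hn⟩ := pow_unbounded_of_one_lt ε⁻¹ (show 1 < 1 + ε by linarith)
    exact ⟨n, inv_le_of_inv_le₀ h0 hn.le⟩
  exact Nat.sInf_mem hne

theorem numClasses_le {ε : ℝ} (h0 : 0 < ε) (h1 : ε < 1) :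
    (numClasses ε : ℝ) ≤ 2 / ε * Real.log (1 / ε) + 1 := by
  have hl : 0 ≤ Real.log (1 / ε) := Real.log_nonneg (by rw [le_div_iff₀ h0]; linarith)
  -- From `log (1 + ε) ≥ 1 - 1 / (1 + ε) = ε / (1 + ε)` and `ε < 1`.
  have hlog : ε / 2 ≤ Real.log (1 + ε) := by
    have := Real.one_sub_inv_le_log_of_pos (show 0 < 1 + ε by linarith)
    refine le_trans ?_ this
    rw [div_le_iff₀ two_pos]
    have : (1 + ε) * (1 + ε)⁻¹ = 1 := mul_inv_cancel₀ (by linarith)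
    have : 0 < (1 + ε)⁻¹ := by positivity
    nlinarith
  refine le_trans ?_ (Nat.ceil_lt_add_one (by positivity)).le
  refine Nat.cast_le.mpr (Nat.sInf_le ?_)
  show ((1 + ε) ^ ⌈2 / ε * Real.log (1 / ε)⌉₊)⁻¹ ≤ ε
  refine inv_le_of_inv_le₀ h0 ?_
  rw [← Real.log_le_log_iff (by positivity) (by positivity), Real.log_pow, ← one_div]
  calc Real.log (1 / ε) = 2 / ε * Real.log (1 / ε) * (ε / 2) := by field_simp
    _ ≤ _ := by gcongr; exact Nat.le_ceil _

theorem countCap_add_one_le {ε : ℝ} (h0 : 0 < ε) (h1 : ε < 1) :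
    ((countCap ε + 1 : ℕ) : ℝ) ≤ 4 * (1 / ε) := by
  have h : 1 ≤ 1 / ε := by rw [le_div_iff₀ h0]; linarith
  have := Nat.ceil_lt_add_one (show 0 ≤ 1 + 1 / ε by positivity)
  rw [countCap]
  push_cast
  linarith

/-- After taking logarithms, with `u = 1/ε` and `l = log u`, the claim follows from `(2ul + 1)(log 4
+ l) ≤ log 4 + 7u²l`: the terms `2ul log 4`, `2ul²` and `l` are at most `4u²l`, `2u²l` and `u²l`,
whence the exponent `7`; the remaining `log 4` gives the factor `4`. -/
theorem card_signature_le {ε : ℝ} (h0 : 0 < ε) (h1 : ε < 1) :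
    (((countCap ε + 1) ^ numClasses ε : ℕ) : ℝ) ≤ 4 * (1 / ε) ^ (7 / ε ^ 2) := by
  have h : 1 ≤ 1 / ε := by rw [le_div_iff₀ h0]; linarith
  have hl : 0 ≤ Real.log (1 / ε) := Real.log_nonneg h
  have hl' : Real.log (1 / ε) ≤ 1 / ε := by
    linarith [Real.log_le_sub_one_of_pos (show 0 < 1 / ε by positivity)]
  have h4 : Real.log 4 ≤ 2 := by
    rw [show (4 : ℝ) = 2 ^ 2 by norm_num, Real.log_pow]
    push_cast
    linarith [Real.log_two_lt_d9]
  have h40 : 0 ≤ Real.log 4 := Real.log_nonneg (by norm_num)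
  push_cast
  have hb : ((countCap ε : ℝ) + 1) ≤ 4 * (1 / ε) := by
    have := countCap_add_one_le h0 h1
    push_cast at this
    exact this
  refine (pow_le_pow_left₀ (by positivity) hb _).trans ?_
  rw [← Real.log_le_log_iff (by positivity) (by positivity), Real.log_pow,
    Real.log_mul (by norm_num) (by positivity), Real.log_mul (by norm_num) (by positivity),
    Real.log_rpow (by positivity)]
  have hK := numClasses_le h0 h1
  set l := Real.log (1 / ε)
  set u := 1 / ε with hu
  have e1 : 2 / ε = 2 * u := by rw [hu]; ring
  have e2 : 7 / ε ^ 2 = 7 * u ^ 2 := by rw [hu]; field_simp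
  rw [e1] at hK
  rw [e2]
  have hmul := mul_le_mul_of_nonneg_right hK (add_nonneg h40 hl)
  refine hmul.trans ?_
  have huu : u ≤ u ^ 2 := by nlinarith
  have a1 : u * l * Real.log 4 ≤ 2 * (u ^ 2 * l) := by
    have : u * l * Real.log 4 ≤ u ^ 2 * l * 2 := by gcongr
    linarith
  have a2 : u * l * l ≤ u ^ 2 * l := by
    calc u * l * l ≤ u * l * u := by gcongr
      _ = _ := by ring
  have a3 : l ≤ u ^ 2 * l := le_mul_of_one_le_left hl (by nlinarith)
  linarith

/-! ### Rounding a point of one piece -/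

variable {η : ℕ} (I : KnapsackCover η)

theorem mem_costClass {ε : ℝ} {h : Fin η} {k : ℕ} {i : Fin η} :
    i ∈ I.costClass ε h k ↔
      I.f i ≤ I.f h / (1 + ε) ^ k ∧ I.f h / (1 + ε) ^ (k + 1) < I.f i ∧ h < i := by
  simp [costClass]

theorem disjoint_costClass {ε : ℝ} (h0 : 0 < ε) (h : Fin η) {k l : ℕ} (hkl : k ≠ l) :
    Disjoint (I.costClass ε h k) (I.costClass ε h l) := by
  wlog hlt : k < l generalizing k l
  · exact (this hkl.symm (by omega)).symm
  refine Finset.disjoint_left.mpr fun i hi hj => ?_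
  rw [mem_costClass] at hi hj
  have : I.f h / (1 + ε) ^ l ≤ I.f h / (1 + ε) ^ (k + 1) :=
    div_le_div_of_nonneg_left (I.f_pos h).le (by positivity)
      (pow_le_pow_right₀ (by linarith) hlt)
  linarith [hi.2.1, hj.1]

/-- The classes partition the cost range below `f_h` without gaps, so each class missed lowers the
bound by a factor `1 + ε`. -/
theorem f_le_of_notMem_costClass {ε : ℝ} {h i : Fin η} (hi : h < i) {K : ℕ}
    (hK : ∀ k < K, i ∉ I.costClass ε h k) : I.f i ≤ I.f h / (1 + ε) ^ K := by
  induction K with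
  | zero => simpa using I.f_sorted hi.le
  | succ K ih =>
    have h1 := ih fun k hk => hK k (by omega)
    have h2 := hK K (by omega)
    rw [mem_costClass] at h2
    by_contra! h3
    exact h2 ⟨h1, h3, hi⟩

/-- Rounding within one cost class of a point of `P^{h,σ}`. -/
theorem exists_round_costClass {ε : ℝ} (h0 : 0 < ε) {h : Fin η} {σ : Signature ε}
    {p : (Fin η → ℝ) × ℝ} (hp : p ∈ I.piece ε h σ) (k : Fin (numClasses ε)) :
    ∃ T ⊆ I.costClass ε h k,
      ∑ i ∈ I.costClass ε h k, I.w i * p.1 i ≤ ∑ i ∈ T, I.w i ∧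
      ∑ i ∈ T, I.f i ≤ (1 + ε) * ∑ i ∈ I.costClass ε h k, I.f i * p.1 i := by
  obtain ⟨h01, -, -, -, -, -, hlt, heq⟩ := hp
  set F := I.f h / (1 + ε) ^ (k : ℕ) with hF
  have hFpos : 0 < F := div_pos (I.f_pos h) (by positivity)
  have hup : ∀ i ∈ I.costClass ε h k, I.f i ≤ F := fun i hi => (I.mem_costClass.mp hi).1
  have hlow : F * ∑ i ∈ I.costClass ε h k, p.1 i ≤
      (1 + ε) * ∑ i ∈ I.costClass ε h k, I.f i * p.1 i := by
    rw [Finset.mul_sum, Finset.mul_sum]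
    refine Finset.sum_le_sum fun i hi => ?_
    have h1 := (I.mem_costClass.mp hi).2.1
    rw [pow_succ, ← div_div, ← hF, div_lt_iff₀ (by positivity)] at h1
    rw [← mul_assoc]
    exact mul_le_mul_of_nonneg_right (by linarith) (h01 i).1
  -- Exact count: swap for equally many whole items. Capped count: round one item up.
  rcases (Nat.lt_succ_iff.mp (σ k).2).lt_or_eq with hk | hk
  · obtain ⟨T, hT, hc, hw⟩ := exists_subset_card_eq_weight_ge (I.costClass ε h k) I.w p.1 (σ k)
      (fun i _ => h01 i) (hlt k hk)
    refine ⟨T, hT, hw, le_trans ?_ hlow⟩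
    rw [hlt k hk, ← hc]
    calc ∑ i ∈ T, I.f i ≤ ∑ i ∈ T, F := Finset.sum_le_sum fun i hi => hup i (hT hi)
      _ = F * T.card := by rw [Finset.sum_const, nsmul_eq_mul, mul_comm]
  · obtain ⟨T, hT, hw, hf⟩ := exists_subset_cover_cost_lt (I.costClass ε h k) I.f I.w p.1 F hFpos
      hup (fun i _ => I.w_pos i) (fun i _ => h01 i)
    refine ⟨T, hT, hw, hf.le.trans ?_⟩
    -- This is where `J ≥ 1 + 1/ε` enters: the class is then so expensive that one extra item, of
    -- cost at most `F`, is an `ε`-fraction of it.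
    have hJ : 1 + 1 / ε ≤ ∑ i ∈ I.costClass ε h k, p.1 i := (Nat.le_ceil _).trans (heq k hk)
    have h1 : F * (1 + 1 / ε) ≤ (1 + ε) * ∑ i ∈ I.costClass ε h k, I.f i * p.1 i :=
      (mul_le_mul_of_nonneg_left hJ hFpos.le).trans hlow
    have h2 : F * (1 + 1 / ε) * ε = F * (1 + ε) := by field_simp; ring
    have h3 : F * (1 + ε) ≤ (1 + ε) * (∑ i ∈ I.costClass ε h k, I.f i * p.1 i) * ε := by
      rw [← h2]; gcongr
    have h4 : F ≤ ε * ∑ i ∈ I.costClass ε h k, I.f i * p.1 i := by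
      refine le_of_mul_le_mul_right ?_ (show 0 < 1 + ε by linarith)
      linarith
    linarith

theorem exists_feasible_cost_lt {ε : ℝ} (h0 : 0 < ε) {h : Fin η} {σ : Signature ε}
    {p : (Fin η → ℝ) × ℝ} (hp : p ∈ I.piece ε h σ) :
    ∃ q ∈ I.feasible, I.cost q < (1 + ε) * I.cost p := by
  classical
  choose T hTs hTw hTf using fun k => I.exists_round_costClass h0 hp k
  obtain ⟨h01, hd, hα0, hαc, hlow, hone, -, -⟩ := hp
  have hdis : Pairwise fun k l : Fin (numClasses ε) =>
      Disjoint (I.costClass ε h k) (I.costClass ε h l) :=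
    fun k l hkl => I.disjoint_costClass h0 h fun e => hkl (Fin.ext e)
  set U := Finset.univ.biUnion fun k : Fin (numClasses ε) => I.costClass ε h k with hU
  set V := Finset.univ.biUnion T with hV
  -- The cheap items: those after `h` that belong to none of the `K` classes.
  set G := Finset.univ.filter fun i => h < i ∧ i ∉ U with hG
  have hM : 0 < ε * I.f h := mul_pos h0 (I.f_pos h)
  have hGf : ∀ i ∈ G, I.f i ≤ ε * I.f h := fun i hi => by
    simp only [hG, hU, Finset.mem_filter, Finset.mem_univ, true_and, Finset.mem_biUnion,
      not_exists] at hi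
    refine (I.f_le_of_notMem_costClass hi.1 fun k hk => hi.2 ⟨k, hk⟩).trans ?_
    rw [div_eq_mul_inv, mul_comm]
    exact mul_le_mul_of_nonneg_right (numClasses_spec h0) (I.f_pos h).le
  obtain ⟨T', hT's, hT'w, hT'f⟩ := exists_subset_cover_cost_lt G I.f I.w p.1 _ hM hGf
    (fun i _ => I.w_pos i) (fun i _ => h01 i)
  have hVU : V ⊆ U := Finset.biUnion_mono fun k _ => hTs k
  have hUG : Disjoint U G := Finset.disjoint_left.mpr fun i hi hj =>
    (Finset.mem_filter.mp hj).2.2 hi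
  have hhUG : h ∉ U ∪ G := by
    simp [hU, hG, mem_costClass]
  have hsum : ∀ g : Fin η → ℝ, ∑ i, g i * p.1 i =
      g h + (∑ k : Fin (numClasses ε), ∑ i ∈ I.costClass ε h k, g i * p.1 i +
        ∑ i ∈ G, g i * p.1 i) := fun g => by
    rw [← Finset.sum_biUnion fun k _ l _ hkl => hdis hkl, ← Finset.sum_union hUG]
    have := Finset.sum_insert (f := fun i => g i * p.1 i) hhUG
    rw [hone, mul_one] at this
    rw [← this]
    refine (Finset.sum_subset (Finset.subset_univ _) fun i _ hi => ?_).symm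
    have : i < h := by
      by_contra! hle
      rcases hle.eq_or_lt with e | hlt
      · exact hi (by simp [e])
      · by_cases hiU : i ∈ U
        · exact hi (by simp [hiU])
        · exact hi (by simp [hG, hlt, hiU])
    rw [hlow i this, mul_zero]
  set X := insert h (V ∪ T')
  have hsumX : ∀ g : Fin η → ℝ, ∑ i, g i * (if i ∈ X then (1 : ℝ) else 0) =
      g h + (∑ k, ∑ i ∈ T k, g i + ∑ i ∈ T', g i) := fun g => by
    rw [← Finset.sum_biUnion fun k _ l _ hkl => (hdis hkl).mono (hTs k) (hTs l),
      ← Finset.sum_union (hUG.mono hVU hT's), ← Finset.sum_insert fun hm =>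
        hhUG (Finset.union_subset_union hVU hT's hm)]
    simp only [mul_ite, mul_one, mul_zero]
    rw [Finset.sum_ite_mem, Finset.univ_inter]
  refine ⟨(fun i => if i ∈ X then 1 else 0, p.2), ⟨?_, hα0, hαc, fun i => ?_⟩, ?_⟩
  · refine hd.trans ?_
    rw [hsum, hsumX]
    have := Finset.sum_le_sum fun k (_ : k ∈ Finset.univ) => hTw k
    linarith
  · dsimp only; split_ifs <;> simp
  · simp only [cost]
    rw [hsum, hsumX]
    have h1 := Finset.sum_le_sum fun k (_ : k ∈ Finset.univ) => hTf k
    rw [← Finset.mul_sum] at h1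
    have h2 : 0 ≤ ∑ i ∈ G, I.f i * p.1 i :=
      Finset.sum_nonneg fun i _ => mul_nonneg (I.f_pos i).le (h01 i).1
    have h3 : 0 ≤ I.v * p.2 := mul_nonneg I.v_pos.le hα0
    -- The extra `ε f_h` from rounding `G` is the slack in `(1 + ε) f_h`; strictness comes from
    -- `hT'f`.
    nlinarith

end KnapsackCover

/-! ### Linear description and compactness of the pieces -/

namespace KnapsackCover

variable {η : ℕ} (I : KnapsackCover η)

/-- The feasible points without items; there are none unless `c = d`. -/
def emptyPiece : Set ((Fin η → ℝ) × ℝ) :=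
  {p | (∀ i, p.1 i = 0) ∧ I.d ≤ p.2 ∧ p.2 ≤ I.c}

/-- The functional `(y, α) ↦ y_i`. -/
def yCoord (i : Fin η) : ((Fin η → ℝ) × ℝ) →ₗ[ℝ] ℝ :=
  LinearMap.proj i ∘ₗ LinearMap.fst ℝ (Fin η → ℝ) ℝ

/-- The functional `(y, α) ↦ α`. -/
def αCoord : ((Fin η → ℝ) × ℝ) →ₗ[ℝ] ℝ :=
  LinearMap.snd ℝ (Fin η → ℝ) ℝ

@[simp] theorem yCoord_apply (i : Fin η) (p : (Fin η → ℝ) × ℝ) : yCoord i p = p.1 i := rfl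

@[simp] theorem αCoord_apply (p : (Fin η → ℝ) × ℝ) : αCoord p = p.2 := rfl

/-- Indices of the inequalities that describe one piece. -/
abbrev PieceRow (η : ℕ) (ε : ℝ) : Type :=
  Fin η ⊕ Fin η ⊕ Fin η ⊕ Fin 3 ⊕ Fin (numClasses ε) ⊕ Fin (numClasses ε)

/-- Left-hand sides of the inequalities for `P^{h,σ}` (index `some (h, σ)`) and for the piece
without items (index `none`). -/
noncomputable def rowMap (ε : ℝ) :
    Option (Fin η × Signature ε) → PieceRow η ε → ((Fin η → ℝ) × ℝ) →ₗ[ℝ] ℝ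
  | some (h, σ) =>
    Sum.elim (fun i => -yCoord i) <| Sum.elim yCoord <|
    -- One inequality per fixed coordinate suffices, the bounds `0 ≤ y_i ≤ 1` giving the other. The
    -- zero rows here and below are vacuous padding, so that all pieces share one index type.
    Sum.elim (fun i => if i < h then yCoord i else if i = h then -yCoord i else 0) <|
    Sum.elim ![-(∑ i, I.w i • yCoord i) - αCoord, -αCoord, αCoord] <|
    -- The lower bound `σ_k` holds in both cases; the matching upper bound is imposed only below the
    -- cap.
    Sum.elim (fun k => -∑ i ∈ I.costClass ε h k, yCoord i)
      (fun k => if (σ k : ℕ) < countCap ε then ∑ i ∈ I.costClass ε h k, yCoord i else 0)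
  | none =>
    Sum.elim (fun i => -yCoord i) <| Sum.elim yCoord <| Sum.elim (fun _ => 0) <|
    Sum.elim ![-αCoord, 0, αCoord] fun _ => 0

/-- Right-hand sides of the inequalities for the pieces. -/
noncomputable def rowBound (ε : ℝ) : Option (Fin η × Signature ε) → PieceRow η ε → ℝ
  | some (h, σ) =>
    Sum.elim (fun _ => 0) <| Sum.elim (fun _ => 1) <|
    Sum.elim (fun i => if i < h then 0 else if i = h then -1 else 0) <|
    Sum.elim ![-I.d, 0, I.c] <|
    Sum.elim (fun k => -((σ k : ℕ) : ℝ))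
      (fun k => if (σ k : ℕ) < countCap ε then ((σ k : ℕ) : ℝ) else 0)
  | none =>
    Sum.elim (fun _ => 0) <| Sum.elim (fun _ => 0) <| Sum.elim (fun _ => 0) <|
    Sum.elim ![-I.d, 0, I.c] fun _ => 0

theorem rowMap_none (ε : ℝ) :
    {p | ∀ r, I.rowMap ε none r p ≤ I.rowBound ε none r} = I.emptyPiece := by
  ext p
  simp only [Set.mem_ofPred_eq, emptyPiece, rowMap, rowBound, Sum.forall, Sum.elim_inl,
    Sum.elim_inr, Fin.forall_fin_succ, Fin.forall_fin_zero]
  simp only [LinearMap.neg_apply, LinearMap.zero_apply, yCoord_apply, αCoord_apply, neg_nonpos,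
    Matrix.cons_val_zero, Matrix.cons_val_succ, le_refl, implies_true, and_true, true_and,
    neg_le_neg_iff]
  exact ⟨fun h => ⟨fun i => le_antisymm (h.2.1 i) (h.1 i), h.2.2⟩,
    fun h => ⟨fun i => (h.1 i).ge, fun i => (h.1 i).le, h.2⟩⟩

theorem rowMap_some (ε : ℝ) (h : Fin η) (σ : Signature ε) :
    {p | ∀ r, I.rowMap ε (some (h, σ)) r p ≤ I.rowBound ε (some (h, σ)) r} = I.piece ε h σ := by
  ext p
  simp only [Set.mem_ofPred_eq, piece, rowMap, rowBound, Sum.forall, Sum.elim_inl,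
    Sum.elim_inr, Fin.forall_fin_succ, Fin.forall_fin_zero]
  simp only [LinearMap.neg_apply, yCoord_apply, αCoord_apply, neg_nonpos, LinearMap.sub_apply,
    LinearMap.sum_apply, LinearMap.smul_apply, smul_eq_mul,
    Matrix.cons_val_zero, Matrix.cons_val_succ, and_true, neg_le_neg_iff]
  constructor
  · rintro ⟨h0, h1, hh, ⟨hd, hα, hc⟩, hge, hle⟩
    refine ⟨fun i => ⟨h0 i, h1 i⟩, by linarith, hα, hc, fun i hi => ?_, ?_, fun k hk => ?_,
      fun k hk => ?_⟩
    · have := hh i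
      simp only [hi, if_true, yCoord_apply] at this
      exact le_antisymm this (h0 i)
    · have := hh h
      simp only [lt_irrefl, if_false, if_true, LinearMap.neg_apply, yCoord_apply] at this
      linarith [h1 h]
    · have := hle k
      simp only [hk, if_true, LinearMap.sum_apply, yCoord_apply] at this
      exact le_antisymm this (hge k)
    · rw [← hk]; exact hge k
  · rintro ⟨h01, hd, hα, hc, hlow, hone, hlt, heq⟩
    refine ⟨fun i => (h01 i).1, fun i => (h01 i).2, fun i => ?_, ⟨by linarith, hα, hc⟩,
      fun k => ?_, fun k => ?_⟩
    · split_ifs with h1 h2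
      · simp [hlow i h1]
      · subst h2; simp [hone]
      · simp
    · rcases (Nat.lt_succ_iff.mp (σ k).2).lt_or_eq with hk | hk
      · exact (hlt k hk).ge
      · rw [hk]; exact heq k hk
    · split_ifs with hk
      · simp [hlt k hk]
      · simp

theorem iUnion_rowMap (ε : ℝ) :
    ⋃ j, {p | ∀ r, I.rowMap ε j r p ≤ I.rowBound ε j r} = I.pieces ε ∪ I.emptyPiece := by
  rw [Set.iUnion_option, rowMap_none, Set.union_comm, Set.iUnion_prod', pieces]
  simp only [rowMap_some]

/-- The pieces are bounded: their rows bound every coordinate from both sides, and the homogeneous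
system forces each to vanish. -/
theorem eq_zero_of_rowMap_nonpos (ε : ℝ) (j : Option (Fin η × Signature ε))
    (p : (Fin η → ℝ) × ℝ) (hp : ∀ r, I.rowMap ε j r p ≤ 0) : p = 0 := by
  have key : (∀ i, 0 ≤ p.1 i) → (∀ i, p.1 i ≤ 0) → 0 ≤ p.2 → p.2 ≤ 0 → p = 0 :=
    fun h1 h2 h3 h4 => Prod.ext (funext fun i => le_antisymm (h2 i) (h1 i)) (le_antisymm h4 h3)
  rcases j with _ | ⟨h, σ⟩
  all_goals
    simp only [rowMap, Sum.forall, Sum.elim_inl, Sum.elim_inr, Fin.forall_fin_succ,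
      Fin.forall_fin_zero] at hp
    simp only [LinearMap.neg_apply, yCoord_apply, αCoord_apply, neg_nonpos,
      Matrix.cons_val_zero, Matrix.cons_val_succ] at hp
  · exact key hp.1 hp.2.1 hp.2.2.2.1.1 hp.2.2.2.1.2.2.1
  · exact key hp.1 hp.2.1 hp.2.2.2.1.2.1 hp.2.2.2.1.2.2.1

theorem isCompact_pieces_union (ε : ℝ) : IsCompact (I.pieces ε ∪ I.emptyPiece) := by
  refine (isCompact_Icc (a := ((0, 0) : (Fin η → ℝ) × ℝ)) (b := (1, I.c))).of_isClosed_subset ?_ ?_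
  · rw [← iUnion_rowMap]
    refine isClosed_iUnion_of_finite fun j => ?_
    simp only [Set.ofPred_forall]
    exact isClosed_iInter fun r =>
      isClosed_le (I.rowMap ε j r).continuous_of_finiteDimensional continuous_const
  · rintro p (hp | hp)
    · obtain ⟨h, σ, hp⟩ := by simpa only [pieces, Set.mem_iUnion] using hp
      exact ⟨⟨fun i => (hp.1 i).1, hp.2.2.1⟩, ⟨fun i => (hp.1 i).2, hp.2.2.2.1⟩⟩
    · have := I.c_pos
      have := I.c_le
      exact ⟨⟨fun i => (hp.1 i).ge, show 0 ≤ p.2 by linarith [hp.2.1]⟩,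
        ⟨fun i => (hp.1 i).le.trans zero_le_one, hp.2.2⟩⟩

theorem feasible_subset_pieces_union {ε : ℝ} : I.feasible ⊆ I.pieces ε ∪ I.emptyPiece := by
  classical
  rintro p ⟨hd, h0, hc, h01⟩
  by_cases hz : ∀ i, p.1 i = 0
  · exact Or.inr ⟨hz, by simpa [hz] using hd, hc⟩
  left
  have hne : (Finset.univ.filter fun i => p.1 i ≠ 0).Nonempty := by
    push Not at hz
    obtain ⟨i, hi⟩ := hz
    exact ⟨i, by simpa using hi⟩
  set h := Finset.min' _ hne with hh
  have hmem := Finset.min'_mem _ hne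
  rw [← hh, Finset.mem_filter] at hmem
  let n : ℕ → ℕ := fun k => ((I.costClass ε h k).filter fun i => p.1 i = 1).card
  have hn : ∀ k, ∑ i ∈ I.costClass ε h k, p.1 i = n k := fun k => by
    simp only [n, Finset.card_filter, Nat.cast_sum]
    refine Finset.sum_congr rfl fun i _ => ?_
    rcases h01 i with hi | hi <;> simp [hi]
  simp only [pieces, Set.mem_iUnion]
  -- The signature records the actual number of chosen items in each class, truncated at `J`.
  refine ⟨h, fun k => ⟨min (n k) (countCap ε), by omega⟩, fun i => ?_, hd, h0, hc, fun i hi => ?_,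
    (h01 h).resolve_left hmem.2, fun k hk => ?_, fun k hk => ?_⟩
  · rcases h01 i with hi | hi <;> simp [hi]
  · by_contra hi'
    exact absurd (Finset.min'_le _ i (by simpa using hi')) (not_le.mpr hi)
  · rw [hn]
    dsimp only at hk ⊢
    rw [min_eq_left (by omega)]
  · rw [hn]
    dsimp only at hk
    exact_mod_cast (show countCap ε ≤ n k by omega)

theorem isCompact_feasible : IsCompact I.feasible := by
  refine (isCompact_Icc (a := ((0, 0) : (Fin η → ℝ) × ℝ)) (b := (1, I.c))).of_isClosed_subset ?_ ?_
  · simp only [feasible, Set.ofPred_and, Set.ofPred_forall, Set.ofPred_or]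
    refine IsClosed.inter ?_ (IsClosed.inter ?_ (IsClosed.inter ?_ (isClosed_iInter fun i =>
      IsClosed.union ?_ ?_)))
    · exact isClosed_le (by fun_prop) (by fun_prop)
    · exact isClosed_le (by fun_prop) (by fun_prop)
    · exact isClosed_le (by fun_prop) (by fun_prop)
    · exact isClosed_eq (by fun_prop) (by fun_prop)
    · exact isClosed_eq (by fun_prop) (by fun_prop)
  · rintro p ⟨-, h0, hc, h01⟩
    refine ⟨⟨fun i => ?_, h0⟩, ⟨fun i => ?_, hc⟩⟩ <;>
    · rcases h01 i with hi | hi <;> simp [hi]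

theorem continuous_cost : Continuous I.cost := by
  unfold cost
  fun_prop

theorem isLinearMap_cost : IsLinearMap ℝ I.cost where
  map_add p q := by
    simp only [cost, Prod.fst_add, Prod.snd_add, Pi.add_apply, mul_add, Finset.sum_add_distrib]
    ring
  map_smul t p := by
    simp only [cost, Prod.smul_fst, Prod.smul_snd, Pi.smul_apply, smul_eq_mul, mul_add,
      Finset.mul_sum]
    congr 1
    · exact Finset.sum_congr rfl fun i _ => by ring
    · ring

theorem emptyPiece_eq_empty (h : I.c < I.d) : I.emptyPiece = ∅ :=
  Set.eq_empty_of_forall_notMem fun p hp => by linarith [hp.2.1, hp.2.2]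

theorem emptyPiece_eq_singleton (h : I.c = I.d) : I.emptyPiece = {((fun _ => 0), I.d)} := by
  ext p
  simp only [emptyPiece, Set.mem_ofPred_eq, Set.mem_singleton_iff, Prod.ext_iff, funext_iff, h]
  exact ⟨fun hp => ⟨hp.1, le_antisymm hp.2.2 hp.2.1⟩, fun hp => ⟨hp.1, hp.2.ge, hp.2.le⟩⟩

/-- Every point of a piece can be rounded to a feasible point within the factor `1 + ε`. -/
theorem exists_feasible_cost_lt_of_mem_union {ε : ℝ} (h0 : 0 < ε) {p : (Fin η → ℝ) × ℝ}
    (hp : p ∈ I.pieces ε ∪ I.emptyPiece) :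
    ∃ q ∈ I.feasible, I.cost q < (1 + ε) * I.cost p := by
  rcases hp with hp | hp
  · obtain ⟨h, σ, hp⟩ := by simpa only [pieces, Set.mem_iUnion] using hp
    exact I.exists_feasible_cost_lt h0 hp
  · have hd : 0 < I.d := I.c_pos.trans_le I.c_le
    refine ⟨p, ⟨by simpa [hp.1] using hp.2.1, by linarith [hp.2.1], hp.2.2,
      fun i => Or.inl (hp.1 i)⟩, ?_⟩
    have : 0 < I.cost p := by
      simp only [cost, hp.1, mul_zero, Finset.sum_const_zero, zero_add]
      exact mul_pos I.v_pos (by linarith [hp.2.1])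
    nlinarith

/-- Here `N` stands for `(J+1)^K`. With `m = η N ≥ 1` bounding both `η` and `K`, the left side is at
most `5m² + 11m + 8 ≤ 24m²`. -/
theorem card_rows_le (hη : 1 ≤ η) {N K : ℕ} (hN : 1 ≤ N) (hK : K ≤ N) :
    (η * N + 1) * (3 * η + 3 + 2 * K) + (η * N + 1) + 2 * (η + 2) ≤ 24 * N ^ 2 * η ^ 2 := by
  have h1 : 1 ≤ η * N := Nat.mul_pos hη hN
  have h2 : η ≤ η * N := Nat.le_mul_of_pos_right _ hN
  have h3 : K ≤ η * N := hK.trans (Nat.le_mul_of_pos_left _ hη)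
  have h4 : 24 * N ^ 2 * η ^ 2 = 24 * (η * N) ^ 2 := by ring
  rw [h4]
  generalize η * N = m at *
  nlinarith

theorem card_vars_le (hη : 1 ≤ η) {N : ℕ} (hN : 1 ≤ N) :
    η + 1 + (η * N + 1) * (η + 2) ≤ 24 * N ^ 2 * η ^ 2 := by
  have h1 : 1 ≤ η * N := Nat.mul_pos hη hN
  have h2 : η ≤ η * N := Nat.le_mul_of_pos_right _ hN
  have h4 : 24 * N ^ 2 * η ^ 2 = 24 * (η * N) ^ 2 := by ring
  rw [h4]
  generalize η * N = m at *
  nlinarith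

/-- Squaring `card_signature_le` gives `384 = 24 · 4²` and `14 = 2 · 7`. -/
theorem size_le {ε : ℝ} (h0 : 0 < ε) (h1 : ε < 1) {n : ℕ}
    (hn : n ≤ 24 * ((countCap ε + 1) ^ numClasses ε) ^ 2 * η ^ 2) :
    (n : ℝ) ≤ 384 * (1 / ε) ^ ((14 : ℝ) / ε ^ 2) * (η : ℝ) ^ 2 := by
  have hN := card_signature_le h0 h1
  refine (Nat.cast_le.mpr hn).trans ?_
  rw [Nat.cast_mul, Nat.cast_mul, Nat.cast_pow _ 2, Nat.cast_pow η 2, Nat.cast_ofNat]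
  refine mul_le_mul_of_nonneg_right ?_ (by positivity)
  have hsq : (1 / ε) ^ ((14 : ℝ) / ε ^ 2) = ((1 / ε) ^ ((7 : ℝ) / ε ^ 2)) ^ 2 := by
    rw [← Real.rpow_mul_natCast (by positivity)]
    congr 1
    push_cast
    ring
  rw [hsq]
  have := pow_le_pow_left₀ (by positivity) hN 2
  rw [mul_pow] at this
  linarith

end KnapsackCover

/-! ### Assembly of the main theorem -/

theorem mainTheorem10 :
    ∃ A B : ℝ, ∀ ε : ℝ, 0 < ε → ε < 1 →
      ∀ η : ℕ, 1 ≤ η → ∀ I : KnapsackCover η, I.feasible.Nonempty →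
        ∃ R : ExtendedSystem η,
          -- size
          (R.numVars : ℝ) ≤ A * (1 / ε) ^ (B / ε ^ 2) * (η : ℝ) ^ 2 ∧
          (R.numCons : ℝ) ≤ A * (1 / ε) ^ (B / ε ^ 2) * (η : ℝ) ^ 2 ∧
          -- the system is a relaxation
          I.feasible ⊆ R.projection ∧
          -- which relaxation it is
          (I.c < I.d → R.projection = convexHull ℝ (I.pieces ε)) ∧
          (I.c = I.d → R.projection = convexHull ℝ (I.pieces ε ∪ {((fun _ => 0), I.d)})) ∧
          -- both optimal values are attained, and they compare as claimed
          ∃ optZ optR : ℝ,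
            IsLeast (I.cost '' I.feasible) optZ ∧
            IsLeast ((fun q => I.cost q.1) '' R.solutions) optR ∧
            optZ < (1 + ε) * optR := by
  refine ⟨384, 14, fun ε h0 h1 η hη I hI => ?_⟩
  obtain ⟨R, hv, hc, hP⟩ := ExtendedSystem.exists_projection_eq_convexHull (I.rowMap ε)
    (I.rowBound ε) (I.eq_zero_of_rowMap_nonpos ε)
  rw [I.iUnion_rowMap] at hP
  have hN : 1 ≤ (KnapsackCover.countCap ε + 1) ^ KnapsackCover.numClasses ε :=
    Nat.one_le_pow _ _ (Nat.succ_pos _)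
  have hcap : 1 < KnapsackCover.countCap ε + 1 :=
    Nat.lt_add_of_pos_left (Nat.ceil_pos.mpr (by positivity))
  have hK : KnapsackCover.numClasses ε ≤
      (KnapsackCover.countCap ε + 1) ^ KnapsackCover.numClasses ε :=
    (Nat.lt_pow_self hcap).le
  have hcard : Fintype.card (Option (Fin η × KnapsackCover.Signature ε)) =
      η * (KnapsackCover.countCap ε + 1) ^ KnapsackCover.numClasses ε + 1 := by
    simp
  have hrows : Fintype.card (KnapsackCover.PieceRow η ε) =
      3 * η + 3 + 2 * KnapsackCover.numClasses ε := by
    simp only [Fintype.card_sum, Fintype.card_fin]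
    ring
  rw [hcard] at hv hc
  rw [hrows] at hc
  have hsub := I.feasible_subset_pieces_union (ε := ε)
  refine ⟨R, KnapsackCover.size_le h0 h1 (hv ▸ KnapsackCover.card_vars_le hη hN),
    KnapsackCover.size_le h0 h1 (hc ▸ KnapsackCover.card_rows_le hη hN hK),
    hP ▸ hsub.trans (subset_convexHull ℝ _), fun h => ?_, fun h => ?_, ?_⟩
  · rw [hP, I.emptyPiece_eq_empty h, Set.union_empty]
  · rw [hP, I.emptyPiece_eq_singleton h]
  obtain ⟨q, hq, hqmin⟩ := I.isCompact_feasible.exists_isMinOn hI I.continuous_cost.continuousOn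
  -- The minimiser is taken over the compact union rather than its hull, so that `p` lies in a
  -- single piece and can be rounded; linearity of the cost makes it optimal over the hull too.
  obtain ⟨p, hp, hpmin⟩ := (I.isCompact_pieces_union ε).exists_isMinOn (hI.mono hsub)
    I.continuous_cost.continuousOn
  refine ⟨I.cost q, I.cost p, ⟨Set.mem_image_of_mem _ hq, ?_⟩, ?_, ?_⟩
  · rintro _ ⟨q', hq', rfl⟩
    exact hqmin hq'
  · have himage : (fun q => I.cost q.1) '' R.solutions = I.cost '' R.projection := by
      rw [ExtendedSystem.projection, Set.image_image]
    rw [himage, hP]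
    refine ⟨Set.mem_image_of_mem _ (subset_convexHull ℝ _ hp), ?_⟩
    rintro _ ⟨p', hp', rfl⟩
    exact convexHull_min (s := I.pieces ε ∪ I.emptyPiece) (t := {x | I.cost p ≤ I.cost x})
      (fun x hx => hpmin hx) (convex_halfSpace_ge I.isLinearMap_cost _) hp'
  · obtain ⟨q', hq', hlt⟩ := I.exists_feasible_cost_lt_of_mem_union h0 hp
    exact (hqmin hq').trans_lt hlt
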